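/- Let $\mathbf{vNA}_{\mathrm{MIU}}$ be the category of von Neumann algebras (on arbitrary Hilbert spaces) and normal unital $*$-homomorphisms, where a map is normal if it is positive and preserves suprema of bounded directed sets of self-adjoint elements. For a von Neumann algebra $\mathscr{A}$ let $\mathrm{nsp}(\mathscr{A})$ be the set of normal unital $*$-homomorphisms $\mathscr{A}\to\mathbb{C}$ (normal characters), and let $\mathrm{nsp}\colon \mathbf{vNA}_{\mathrm{MIU}}\to\mathbf{Set}^{\mathrm{op}}$ be the functor with $\mathrm{nsp}(f)(\varphi)=\varphi\circ f$. Then $\mathrm{nsp}$ preserves products and tensors. In detail: 1. (Products.) $\mathrm{nsp}$ preserves all small products. For every set $I$ and every family $(\mathscr{A}_i)_{i\in I}$ of von Neumann algebras, the direct sum $\bigoplus_{i\in I}\mathscr{A}_i$ (the bounded diagonal operators with entries in the $\mathscr{A}_i$, acting on the Hilbert space direct sum) with its projections $\pi_i$ is the product in $\mathbf{vNA}_{\mathrm{MIU}}$, and the map $\coprod_{i\in I}\mathrm{nsp}(\mathscr{A}_i)\to\mathrm{nsp}(\bigoplus_{i\in I}\mathscr{A}_i)$, $(i,\varphi)\mapsto\varphi\circ\pi_i$,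 is a bijection. That is, every normal character of the direct sum factors through exactly one summand, by a unique normal character of that summand. 2. (Tensors.) Let $\mathscr{A}_1\otimes\mathscr{A}_2$ be the spatial tensor product: the least von Neumann algebra on the Hilbert space tensor product that contains all operators $a_1\otimes a_2$ with $a_i\in\mathscr{A}_i$. For every $\omega\in\mathrm{nsp}(\mathscr{A}_1\otimes\mathscr{A}_2)$ there is a unique pair $(\omega_1,\omega_2)\in\mathrm{nsp}(\mathscr{A}_1)\times\mathrm{nsp}(\mathscr{A}_2)$ with $\omega(a_1\otimes a_2)=\omega_1(a_1)\,\omega_2(a_2)$ for all $a_i\in\mathscr{A}_i$; conversely, for every such pair there is a unique $\omega\in\mathrm{nsp}(\mathscr{A}_1\otimes\mathscr{A}_2)$ with this property. The resulting bijections $\mathrm{nsp}(\mathscr{A}_1\otimes\mathscr{A}_2)\cong\mathrm{nsp}(\mathscr{A}_1)\times\mathrm{nsp}(\mathscr{A}_2)$ are natural: if $f_i\colon\mathscr{A}_i\to\mathscr{B}_i$ and $F\colon\mathscr{A}_1\otimes\mathscr{A}_2\to\mathscr{B}_1\otimes\mathscr{B}_2$ are normal unital $*$-homomorphisms with $F(a_1\otimes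 a_2)=f_1(a_1)\otimes f_2(a_2)$ for all $a_i\in\mathscr{A}_i$ (that is, $F=f_1\otimes f_2$), then for every $\omega\in\mathrm{nsp}(\mathscr{B}_1\otimes\mathscr{B}_2)$ the character $\omega\circ F$ corresponds to $(\omega_1\circ f_1,\omega_2\circ f_2)$. Moreover $\mathrm{nsp}(\mathbb{C})$ has exactly one element. -/

import Mathlib

open CategoryTheory CategoryTheory.Limits
open scoped TensorProduct InnerProductSpace

universe u

noncomputable section

/-! ## Order and normality -/

section Order

variable {A B C : Type*} [Ring A] [StarRing A] [Ring B] [StarRing B] [Ring C] [StarRing C]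

/-- An element of a `*`-ring is positive if it is of the form `b* b`. -/
def IsPos (a : A) : Prop := ∃ b : A, a = star b * b

/-- `s` is the supremum of `D` in the set of self-adjoint elements, where `a ≤ b` means that
`b - a` is positive. -/
def IsSupSA (D : Set A) (s : A) : Prop :=
  IsSelfAdjoint s ∧ (∀ d ∈ D, IsPos (s - d)) ∧
    ∀ t : A, IsSelfAdjoint t → (∀ d ∈ D, IsPos (t - d)) → IsPos (t - s)

/-- A map is normal if it is positive and preserves the suprema of bounded (upwards) directed sets
of self-adjoint elements. (A set that has a supremum is bounded.) -/
def IsNormal (f : A → B) : Prop :=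
  (∀ a, IsPos a → IsPos (f a)) ∧
    ∀ (D : Set A) (s : A), D.Nonempty → (∀ d ∈ D, IsSelfAdjoint d) →
      DirectedOn (fun a b => IsPos (b - a)) D → IsSupSA D s → IsSupSA (f '' D) (f s)

lemma IsNormal.id : IsNormal (fun a : A => a) := by
  refine ⟨fun _ h => h, fun D s _ _ _ h => ?_⟩
  simpa using h

end Order

section Hom

variable {A B C : Type*} [Ring A] [StarRing A] [Algebra ℂ A]
  [Ring B] [StarRing B] [Algebra ℂ B] [Ring C] [StarRing C] [Algebra ℂ C]

lemma StarAlgHom.isPos_map (f : A →⋆ₐ[ℂ] B) {a : A} (h : IsPos a) : IsPos (f a) := by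
  obtain ⟨b, rfl⟩ := h
  exact ⟨f b, by rw [map_mul, map_star]⟩

lemma IsNormal.comp {g : B →⋆ₐ[ℂ] C} {f : A →⋆ₐ[ℂ] B} (hg : IsNormal g) (hf : IsNormal f) :
    IsNormal (g.comp f) := by
  refine ⟨fun a h => (g.comp f).isPos_map h, fun D s hne hsa hdir hs => ?_⟩
  have h := hg.2 (f '' D) (f s) (hne.image f) ?_ ?_ (hf.2 D s hne hsa hdir hs)
  · have e : (⇑(g.comp f)) '' D = g '' (f '' D) := by
      rw [Set.image_image]; rfl
    rw [e]; exact h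
  · rintro _ ⟨d, hd, rfl⟩
    exact (hsa d hd).map f
  · rintro _ ⟨a, ha, rfl⟩ _ ⟨b, hb, rfl⟩
    obtain ⟨c, hc, h1, h2⟩ := hdir a ha b hb
    refine ⟨f c, ⟨c, hc, rfl⟩, ?_, ?_⟩
    · have := f.isPos_map h1
      rwa [map_sub] at this
    · have := f.isPos_map h2
      rwa [map_sub] at this

end Hom

/-! ## The category of von Neumann algebras and normal unital `*`-homomorphisms -/

/-- A von Neumann algebra on a Hilbert space. -/
structure VNA : Type (u + 1) where
  /-- The Hilbert space. -/
  space : Type u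
  [normed : NormedAddCommGroup space]
  [hilbert : InnerProductSpace ℂ space]
  [complete : CompleteSpace space]
  /-- The algebra of operators. -/
  alg : VonNeumannAlgebra space

namespace VNA

attribute [instance] VNA.normed VNA.hilbert VNA.complete

/-- The `*`-algebra of elements of a von Neumann algebra. -/
abbrev Elem (A : VNA.{u}) : Type u := A.alg.toStarSubalgebra

/-- Normal MIU-maps: the normal unital `*`-homomorphisms. -/
abbrev NormalMIU (A B : VNA.{u}) : Type u := {f : A.Elem →⋆ₐ[ℂ] B.Elem // IsNormal f}

/-- The category of von Neumann algebras and normal MIU-maps. -/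
instance : Category VNA.{u} where
  Hom A B := NormalMIU A B
  id A := ⟨StarAlgHom.id ℂ A.Elem, IsNormal.id⟩
  comp f g := ⟨g.1.comp f.1, g.2.comp f.2⟩

/-- The underlying unital `*`-homomorphism of a morphism. -/
def hom {A B : VNA.{u}} (f : A ⟶ B) : A.Elem →⋆ₐ[ℂ] B.Elem := Subtype.val f

lemma isNormal_hom {A B : VNA.{u}} (f : A ⟶ B) : IsNormal (hom f) := Subtype.property f

/-! ### The normal spectrum -/

/-- The normal spectrum of `A`: the set of normal MIU-maps `A → ℂ`. -/
def Nsp (A : VNA.{u}) : Type u := {φ : A.Elem →⋆ₐ[ℂ] ℂ // IsNormal φ}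

instance (A : VNA.{u}) : CoeFun A.Nsp (fun _ => A.Elem → ℂ) := ⟨fun φ => φ.1⟩

/-- Precomposition of a normal character with a normal MIU-map. -/
def Nsp.comp {A B : VNA.{u}} (φ : B.Nsp) (f : A ⟶ B) : A.Nsp :=
  ⟨φ.1.comp (hom f), φ.2.comp (isNormal_hom f)⟩

/-- The normal spectrum functor to the opposite of the category of sets. -/
def nsp : VNA.{u} ⥤ (Type u)ᵒᵖ where
  obj A := Opposite.op A.Nsp
  map {A B} f := Quiver.Hom.op (X := B.Nsp) (Y := A.Nsp) (TypeCat.ofHom fun φ => φ.comp f)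

/-! ### Direct sums -/

section DirectSum

variable {ι : Type u} (A : ι → VNA.{u})

/-- The Hilbert space direct sum. -/
abbrev sumSpace : Type u := lp (fun i => (A i).space) 2

open Classical in
/-- The inclusion of a summand. -/
def incl (i : ι) : (A i).space →L[ℂ] sumSpace A :=
  lp.singleContinuousLinearMap ℂ (fun i => (A i).space) 2 i

/-- The projection on a summand. -/
def proj (i : ι) : sumSpace A →L[ℂ] (A i).space :=
  lp.evalCLM ℂ (fun i => (A i).space) 2 i

@[simp] lemma proj_apply (i : ι) (x : sumSpace A) : proj A i x = x i := rfl

@[simp] lemma incl_apply_same (i : ι) (x : (A i).space) : incl A i x i = x := by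
  classical
  exact lp.single_apply_self (E := fun i => (A i).space) 2 i x

lemma incl_apply_ne {i j : ι} (h : j ≠ i) (x : (A i).space) : incl A i x j = 0 := by
  classical
  exact lp.single_apply_ne (E := fun i => (A i).space) 2 i x h

lemma inner_incl_left (i : ι) (x : (A i).space) (y : sumSpace A) :
    ⟪incl A i x, y⟫_ℂ = ⟪x, y i⟫_ℂ := by
  classical
  exact lp.inner_single_left (𝕜 := ℂ) (G := fun i => (A i).space) i x y

/-- The operator acting as `a` on the summand `i` and as `0` on the other summands. -/
def block (i : ι) (a : (A i).space →L[ℂ] (A i).space) : sumSpace A →L[ℂ] sumSpace A :=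
  incl A i ∘L a ∘L proj A i

@[simp] lemma block_apply_same (i : ι) (a : (A i).space →L[ℂ] (A i).space) (x : sumSpace A) :
    block A i a x i = a (x i) := by simp [block]

lemma block_apply_ne {i j : ι} (h : j ≠ i) (a : (A i).space →L[ℂ] (A i).space)
    (x : sumSpace A) : block A i a x j = 0 := by simp [block, incl_apply_ne A h]

/-- The `i`-th diagonal entry of an operator on the Hilbert space direct sum. -/
def entry (i : ι) (T : sumSpace A →L[ℂ] sumSpace A) : (A i).space →L[ℂ] (A i).space :=
  proj A i ∘L T ∘L incl A i

lemma entry_apply (i : ι) (T : sumSpace A →L[ℂ] sumSpace A) (x : (A i).space) :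
    entry A i T x = T (incl A i x) i := rfl

/-- `T` is a diagonal operator whose `i`-th entry is in the `i`-th algebra, for every `i`. -/
def IsDiag (T : sumSpace A →L[ℂ] sumSpace A) : Prop :=
  ∀ i, ∃ a ∈ (A i).alg, ∀ x : sumSpace A, T x i = a (x i)

variable {A} in
lemma IsDiag.entry_eq {T : sumSpace A →L[ℂ] sumSpace A} {i : ι}
    {a : (A i).space →L[ℂ] (A i).space} (h : ∀ x : sumSpace A, T x i = a (x i)) :
    entry A i T = a := by
  ext x
  rw [entry_apply, h, incl_apply_same]

variable {A} in
lemma IsDiag.entry_mem {T : sumSpace A →L[ℂ] sumSpace A} (h : IsDiag A T) (i : ι) :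
    entry A i T ∈ (A i).alg := by
  obtain ⟨a, ha, h⟩ := h i
  rwa [IsDiag.entry_eq h]

variable {A} in
lemma IsDiag.apply {T : sumSpace A →L[ℂ] sumSpace A} (h : IsDiag A T) (i : ι) (x : sumSpace A) :
    T x i = entry A i T (x i) := by
  obtain ⟨a, ha, h⟩ := h i
  rw [IsDiag.entry_eq h, h]

lemma isDiag_smul_one (r : ℂ) : IsDiag A (algebraMap ℂ _ r) := fun i =>
  ⟨algebraMap ℂ _ r, (A i).alg.algebraMap_mem r, fun x => by
    simp [Algebra.algebraMap_eq_smul_one]⟩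

/-- The bounded diagonal operators form a unital `*`-subalgebra. -/
def sumStarSubalgebra : StarSubalgebra ℂ (sumSpace A →L[ℂ] sumSpace A) where
  carrier := {T | IsDiag A T}
  mul_mem' {S T} hS hT i :=
    ⟨entry A i S * entry A i T, mul_mem (hS.entry_mem i) (hT.entry_mem i), fun x => by
      simp [hS.apply i, hT.apply i]⟩
  add_mem' {S T} hS hT i :=
    ⟨entry A i S + entry A i T, add_mem (hS.entry_mem i) (hT.entry_mem i), fun x => by
      simp [hS.apply i, hT.apply i]⟩
  algebraMap_mem' r := isDiag_smul_one A r
  star_mem' {T} hT i :=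
    ⟨star (entry A i T), star_mem (hT.entry_mem i), fun x => by
      refine ext_inner_left ℂ fun y => ?_
      rw [ContinuousLinearMap.star_eq_adjoint, ContinuousLinearMap.star_eq_adjoint,
        ContinuousLinearMap.adjoint_inner_right, ← inner_incl_left,
        ContinuousLinearMap.adjoint_inner_right]
      have : T (incl A i y) = incl A i (entry A i T y) := by
        ext j
        by_cases h : j = i
        · subst h; rw [incl_apply_same, entry_apply]
        · rw [hT.apply j, incl_apply_ne A h, incl_apply_ne A h, map_zero]
      rw [this, inner_incl_left]⟩

lemma mem_sumStarSubalgebra {T : sumSpace A →L[ℂ] sumSpace A} :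
    T ∈ sumStarSubalgebra A ↔ IsDiag A T := Iff.rfl

variable {A} in
lemma IsDiag.commute_block {T : sumSpace A →L[ℂ] sumSpace A} (hT : IsDiag A T) {i : ι}
    {b : (A i).space →L[ℂ] (A i).space} (hb : ∀ a ∈ (A i).alg, a * b = b * a) :
    T * block A i b = block A i b * T := by
  ext x j
  by_cases h : j = i
  · subst h
    have := congrArg (fun S => S (x j)) (hb _ (hT.entry_mem j))
    simpa [hT.apply j] using this
  · simp [hT.apply j, block_apply_ne A h]

/-- The direct sum of a family of von Neumann algebras: it consists of the bounded operators
`(xᵢ)ᵢ ↦ (aᵢ xᵢ)ᵢ` on the Hilbert space direct sum, with each `aᵢ` in the `i`-th algebra.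
(Boundedness amounts to `sup ‖aᵢ‖ < ∞`.) -/
def directSum : VNA.{u} where
  space := sumSpace A
  alg :=
    { sumStarSubalgebra A with
      centralizer_centralizer' := by
        refine Set.Subset.antisymm (fun T hT => ?_) Set.subset_centralizer_centralizer
        have key : ∀ (i : ι) (b : (A i).space →L[ℂ] (A i).space),
            (∀ a ∈ (A i).alg, a * b = b * a) → block A i b * T = T * block A i b := by
          intro i b hb
          exact hT _ fun S hS => IsDiag.commute_block (A := A) hS hb
        intro i
        have h1 : ∀ x : sumSpace A, T x i = entry A i T (x i) := by
          intro x
          have := congrArg (fun S => S x i) (key i 1 (fun a _ => by simp))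
          simpa [block, entry] using this
        refine ⟨entry A i T, ?_, h1⟩
        have h2 : entry A i T ∈ Set.centralizer (Set.centralizer ((A i).alg : Set _)) := by
          intro b hb
          ext x
          have := congrArg (fun S => S (incl A i x) i) (key i b hb)
          simpa [block, entry] using this
        rwa [VonNeumannAlgebra.centralizer_centralizer] at h2 }

lemma entry_mul {S T : sumSpace A →L[ℂ] sumSpace A} (hS : IsDiag A S) (i : ι) :
    entry A i (S * T) = entry A i S * entry A i T := by
  ext x
  rw [entry_apply, mul_apply_eq_comp, mul_apply_eq_comp, hS.apply i]
  rfl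

lemma entry_star {i : ι} (T : sumSpace A →L[ℂ] sumSpace A) :
    entry A i (star T) = star (entry A i T) := by
  ext x
  refine ext_inner_left ℂ fun y => ?_
  rw [ContinuousLinearMap.star_eq_adjoint, ContinuousLinearMap.star_eq_adjoint,
    ContinuousLinearMap.adjoint_inner_right, entry_apply, ← inner_incl_left,
    ContinuousLinearMap.adjoint_inner_right, entry_apply]
  rw [← inner_conj_symm, ← inner_conj_symm (T (incl A i y) i), inner_incl_left]

/-- The projection of a direct sum on a summand, as a `*`-homomorphism. -/
def sumProjHom (i : ι) : (directSum A).Elem →⋆ₐ[ℂ] (A i).Elem where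
  toFun T := ⟨entry A i T.1, IsDiag.entry_mem (A := A) T.2 i⟩
  map_one' := Subtype.ext <| by
    ext x
    change incl A i x i = x
    simp
  map_zero' := Subtype.ext <| by ext x; rfl
  map_mul' S T := Subtype.ext <| entry_mul A S.2 i
  map_add' S T := Subtype.ext <| by ext x; rfl
  commutes' r := Subtype.ext <| by
    ext x
    change (r • incl A i x : sumSpace A) i = r • x
    simp
  map_star' T := Subtype.ext <| entry_star A T.1

lemma isDiag_block {i : ι} {a : (A i).space →L[ℂ] (A i).space} (ha : a ∈ (A i).alg) :
    IsDiag A (block A i a) := by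
  intro j
  by_cases h : j = i
  · subst h; exact ⟨a, ha, block_apply_same A j a⟩
  · exact ⟨0, zero_mem _, fun x => by simp [block_apply_ne A h]⟩

/-- `block`, on elements of the algebras. -/
def blockElem (i : ι) (a : (A i).Elem) : (directSum A).Elem :=
  ⟨block A i a.1, isDiag_block A a.2⟩

variable {A} in
lemma IsDiag.ext {S T : sumSpace A →L[ℂ] sumSpace A} (hS : IsDiag A S) (hT : IsDiag A T)
    (h : ∀ i, entry A i S = entry A i T) : S = T := by
  ext x i
  rw [hS.apply i, hT.apply i, h i]

lemma elem_ext {S T : (directSum A).Elem} (h : ∀ i, sumProjHom A i S = sumProjHom A i T) :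
    S = T :=
  Subtype.ext (IsDiag.ext (A := A) S.2 T.2 fun i => congrArg Subtype.val (h i))

lemma sumProjHom_blockElem (i : ι) (a : (A i).Elem) : sumProjHom A i (blockElem A i a) = a := by
  refine Subtype.ext ?_
  ext x
  change block A i a.1 (incl A i x) i = a.1 x
  simp

lemma sumProjHom_blockElem_ne {i j : ι} (h : j ≠ i) (a : (A i).Elem) :
    sumProjHom A j (blockElem A i a) = 0 := by
  refine Subtype.ext ?_
  ext x
  change block A i a.1 (incl A j x) j = 0
  rw [block_apply_ne A h]

/-- The projection of a direct sum on a summand is normal. -/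
lemma isNormal_sumProjHom (i : ι) : IsNormal (sumProjHom A i) := by
  refine ⟨fun a h => StarAlgHom.isPos_map _ h, fun D s _ _ _ hs => ⟨hs.1.map _, ?_, ?_⟩⟩
  · rintro _ ⟨d, hd, rfl⟩
    have := (sumProjHom A i).isPos_map (hs.2.1 d hd)
    rwa [map_sub] at this
  · intro t ht hub
    -- replace the `i`-th entry of `s` by `t`
    let s' : (directSum A).Elem := s - blockElem A i (sumProjHom A i s) + blockElem A i t
    have e1 : sumProjHom A i s' = t := by
      simp only [s', map_add, map_sub, sumProjHom_blockElem, sub_self, zero_add]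
    have e2 : ∀ j, j ≠ i → sumProjHom A j s' = sumProjHom A j s := by
      intro j h
      simp only [s', map_add, map_sub, sumProjHom_blockElem_ne A h, sub_zero, add_zero]
    have hs' : IsSelfAdjoint s' := by
      refine elem_ext A fun j => ?_
      by_cases h : j = i
      · subst h; rw [map_star, e1]; exact ht
      · rw [map_star, e2 j h]; exact hs.1.map _
    have := (sumProjHom A i).isPos_map (hs.2.2 s' hs' ?_)
    · rwa [map_sub, e1] at this
    · intro d hd
      obtain ⟨C, hC⟩ := hs.2.1 d hd
      obtain ⟨c, hc⟩ := hub _ ⟨d, hd, rfl⟩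
      refine ⟨C - blockElem A i (sumProjHom A i C) + blockElem A i c, elem_ext A fun j => ?_⟩
      by_cases h : j = i
      · subst h
        rw [map_sub, e1, hc]
        simp only [map_mul, map_star, map_add, map_sub, sumProjHom_blockElem, sub_self, zero_add]
      · rw [map_sub, e2 j h, ← map_sub, hC]
        simp only [map_mul, map_star, map_add, map_sub, sumProjHom_blockElem_ne A h, sub_zero,
          add_zero]

/-- The projection of a direct sum on a summand, as a morphism. -/
def sumProj (i : ι) : directSum A ⟶ A i := ⟨sumProjHom A i, isNormal_sumProjHom A i⟩

/-- The direct sum with its projections, as a fan. -/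
def directSumFan : Fan A := Fan.mk (directSum A) (sumProj A)

end DirectSum

/-! ### Tensor products -/

/-- The least von Neumann algebra containing a set of operators: the intersection of all von
Neumann algebras that contain it. -/
def generated {H : Type u} [NormedAddCommGroup H] [InnerProductSpace ℂ H] [CompleteSpace H]
    (S : Set (H →L[ℂ] H)) : VonNeumannAlgebra H where
  carrier := {T | ∀ N : VonNeumannAlgebra H, S ⊆ N → T ∈ N}
  mul_mem' hS hT N hN := mul_mem (hS N hN) (hT N hN)
  add_mem' hS hT N hN := add_mem (hS N hN) (hT N hN)
  algebraMap_mem' r N _ := N.algebraMap_mem r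
  star_mem' hT N hN := star_mem (hT N hN)
  centralizer_centralizer' := by
    refine Set.Subset.antisymm (fun T hT N hN => ?_) Set.subset_centralizer_centralizer
    rw [← SetLike.mem_coe, ← N.centralizer_centralizer]
    refine Set.centralizer_subset (Set.centralizer_subset ?_) hT
    exact fun X (hX : ∀ N : VonNeumannAlgebra H, S ⊆ N → X ∈ N) => hX N hN

section Tensor

variable (A B : VNA.{u})

/-- The Hilbert space tensor product. -/
abbrev tensorSpace : Type u := UniformSpace.Completion (A.space ⊗[ℂ] B.space)

variable {A B} in
/-- The operator `a ⊗ b`, determined by `(a ⊗ b)(x ⊗ y) = a x ⊗ b y`. -/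
def tensorOp (a : A.space →L[ℂ] A.space) (b : B.space →L[ℂ] B.space) :
    tensorSpace A B →L[ℂ] tensorSpace A B :=
  (TensorProduct.mapL a b).completion

variable {A B} in
lemma tensorOp_tmul (a : A.space →L[ℂ] A.space) (b : B.space →L[ℂ] B.space) (x : A.space)
    (y : B.space) : tensorOp a b ((x ⊗ₜ[ℂ] y : A.space ⊗[ℂ] B.space) : tensorSpace A B) =
      ((a x ⊗ₜ[ℂ] b y : A.space ⊗[ℂ] B.space) : tensorSpace A B) := by
  simp [tensorOp]

/-- The spatial tensor product: the least von Neumann algebra on the Hilbert space tensor product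
that contains the operators `a ⊗ b`. -/
def tensor : VNA.{u} where
  space := tensorSpace A B
  alg := generated {T | ∃ a ∈ A.alg, ∃ b ∈ B.alg, T = tensorOp a b}

variable {A B} in
/-- The element `a ⊗ b` of the spatial tensor product. -/
def tmul (a : A.Elem) (b : B.Elem) : (tensor A B).Elem :=
  ⟨tensorOp a.1 b.1, fun _ hN => hN ⟨a.1, a.2, b.1, b.2, rfl⟩⟩

end Tensor

/-- The tensor unit: the von Neumann algebra of all operators on a one-dimensional Hilbert space,
that is, `ℂ`. -/
def unit : VNA.{u} where
  space := EuclideanSpace ℂ PUnit.{u + 1}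
  alg :=
    { (⊤ : StarSubalgebra ℂ _) with
      centralizer_centralizer' :=
        Set.Subset.antisymm (fun _ _ => trivial) Set.subset_centralizer_centralizer }

end VNA

end

/-! A character of a von Neumann algebra is normal exactly when it is the eigenvalue function of a
common eigenvector: a nonzero `ξ` with `a ξ = φ(a) ξ` for all `a`. Both halves of the theorem then
become statements about vectors.

Normal gives eigenvector (`Nsp.exists_eigenvector`): an increasing approximate unit of `ker φ` has a
supremum `q` in the algebra, by Vigier's theorem. Normality gives `φ(q) = 0`, so `q ≠ 1`, while
every element of `ker φ` annihilates the range of `1 - q`; nonzero vectors there are eigenvectors.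
Eigenvector gives normal (`isNormal_of_eigenvector`): suprema are limits of quadratic forms, which
can be evaluated at `ξ`.

For a direct sum, an eigenvector has a nonzero coordinate, and that coordinate is an eigenvector of
its summand. For a tensor product, `ξ ⊗ η` is an eigenvector if `ξ` and `η` are; conversely,
contracting an eigenvector with `y` or with `x`, where `x ⊗ y` is not orthogonal to it, gives
eigenvectors of the factors. Elementary tensors control the whole tensor product because rank-one
operators between eigenvectors commute with the generators, hence with the generated algebra
(`inner_smul_eq_of_eigenvectors`). -/

/-! ### Strong suprema of bounded directed sets of operators. -/

section Operators

open Filter Topology ContinuousLinearMap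
open scoped ComplexOrder

variable {H : Type*} [NormedAddCommGroup H] [InnerProductSpace ℂ H]

/-- An operator is positive if its quadratic form is. -/
lemma ContinuousLinearMap.nonneg_of_inner {T : H →L[ℂ] H} (h : ∀ x, 0 ≤ ⟪T x, x⟫_ℂ) : 0 ≤ T := by
  rw [nonneg_iff_isPositive, isPositive_iff_complex]
  intro x
  have := Complex.nonneg_iff.1 (h x)
  exact ⟨Complex.ext (by simp) (by simpa using this.2), this.1⟩

lemma ContinuousLinearMap.inner_nonneg {T : H →L[ℂ] H} (h : 0 ≤ T) (x : H) : 0 ≤ ⟪T x, x⟫_ℂ :=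
  ((nonneg_iff_isPositive T).1 h).inner_nonneg_left x

variable [CompleteSpace H]

/-- Write `T = b* b` and use `‖T‖ = ‖b‖²`. This upgrades convergence of quadratic forms to strong
convergence for monotone nets. -/
lemma ContinuousLinearMap.norm_sq_apply_le {T : H →L[ℂ] H} (h : 0 ≤ T) (x : H) :
    ‖T x‖ ^ 2 ≤ ‖T‖ * (⟪T x, x⟫_ℂ).re := by
  obtain ⟨b, rfl⟩ := CStarAlgebra.nonneg_iff_eq_star_mul_self.1 h
  have e : ⟪(star b * b) x, x⟫_ℂ = ⟪b x, b x⟫_ℂ := by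
    rw [mul_apply_eq_comp, star_eq_adjoint, adjoint_inner_left]
  have e2 : (⟪b x, b x⟫_ℂ).re = ‖b x‖ ^ 2 := inner_self_eq_norm_sq (𝕜 := ℂ) (b x)
  rw [e, e2, CStarRing.norm_star_mul_self, mul_apply_eq_comp]
  calc ‖star b (b x)‖ ^ 2 ≤ (‖star b‖ * ‖b x‖) ^ 2 := by gcongr; exact le_opNorm _ _
    _ = ‖b‖ * ‖b‖ * ‖b x‖ ^ 2 := by rw [norm_star]; ring

/-- Vigier's theorem for a set with a least element. -/
lemma ContinuousLinearMap.exists_strong_sup_of_bot {D : Set (H →L[ℂ] H)} {d₀ t : H →L[ℂ] H}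
    (hd₀ : d₀ ∈ D) (hbot : ∀ d ∈ D, d₀ ≤ d) (hdir : DirectedOn (· ≤ ·) D) (ht : ∀ d ∈ D, d ≤ t) :
    ∃ T : H →L[ℂ] H, (∀ d ∈ D, d ≤ T) ∧
      (∀ x, ∀ ε > 0, ∃ d ∈ D, (⟪(T - d) x, x⟫_ℂ).re < ε) ∧
      ∀ X : H →L[ℂ] H, (∀ d ∈ D, X * d = d * X) → X * T = T * X := by
  have : Nonempty D := ⟨⟨d₀, hd₀⟩⟩
  have : IsDirectedOrder D := directedOn_iff_isDirectedOrder.1 hdir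
  set M := ‖t - d₀‖
  -- The least element is needed here: `0 ≤ d' - d ≤ t - d₀` bounds all increments uniformly.
  have hM : ∀ d ∈ D, ∀ d' ∈ D, d ≤ d' → ‖d' - d‖ ≤ M := fun d hd d' hd' h =>
    CStarAlgebra.norm_le_norm_of_nonneg_of_le (sub_nonneg.2 h)
      (sub_le_sub (ht d' hd') (hbot d hd))
  have hcauchy : ∀ x, Cauchy (map (fun d : D => d.1 x) atTop) := by
    intro x
    rw [Metric.cauchy_iff]
    refine ⟨inferInstance, fun ε hε => ?_⟩
    let q : D → ℝ := fun d => (⟪d.1 x, x⟫_ℂ).re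
    have hq : ∀ {d d' : H →L[ℂ] H}, d ≤ d' → (⟪d x, x⟫_ℂ).re ≤ (⟪d' x, x⟫_ℂ).re := by
      intro d d' h
      have := (Complex.nonneg_iff.1 (inner_nonneg (sub_nonneg.2 h) x)).1
      rw [sub_apply, inner_sub_left, Complex.sub_re] at this
      linarith
    have hb : BddAbove (Set.range q) := ⟨(⟪t x, x⟫_ℂ).re, by
      rintro _ ⟨d, rfl⟩; exact hq (ht d d.2)⟩
    -- If `q d₁` is within `δ` of the supremum, later increments satisfy `‖(d - d₁) x‖² ≤ M δ < (ε /
    -- 2)²`; `M + 1` covers `M = 0`.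
    set δ := (ε / 2) ^ 2 / (M + 1)
    have hM0 : 0 ≤ M := norm_nonneg _
    have hδ : 0 < δ := by positivity
    obtain ⟨d₁, h₁⟩ := exists_lt_of_lt_ciSup (sub_lt_self (⨆ d, q d) hδ)
    have key : ∀ d : D, d₁ ≤ d → dist (d.1 x) (d₁.1 x) < ε / 2 := by
      intro d hd
      have h1 := norm_sq_apply_le (sub_nonneg.2 (show d₁.1 ≤ d.1 from hd)) x
      have h2 : (⟪(d.1 - d₁.1) x, x⟫_ℂ).re < δ := by
        rw [sub_apply, inner_sub_left, Complex.sub_re]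
        have := le_ciSup hb d
        change q d - q d₁ < δ
        linarith
      have h0 := (Complex.nonneg_iff.1 (inner_nonneg (sub_nonneg.2 (show d₁.1 ≤ d.1 from hd)) x)).1
      rw [dist_eq_norm, ← sub_apply]
      refine lt_of_pow_lt_pow_left₀ 2 (by positivity) (h1.trans_lt ?_)
      calc ‖d.1 - d₁.1‖ * (⟪(d.1 - d₁.1) x, x⟫_ℂ).re
          ≤ M * (⟪(d.1 - d₁.1) x, x⟫_ℂ).re := by
            gcongr; exact hM _ d₁.2 _ d.2 hd
        _ ≤ (M + 1) * (⟪(d.1 - d₁.1) x, x⟫_ℂ).re := by gcongr; linarith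
        _ < (M + 1) * δ := by gcongr
        _ = (ε / 2) ^ 2 := by simp only [δ]; field_simp
    refine ⟨(fun d : D => d.1 x) '' Set.Ici d₁, image_mem_map (Ici_mem_atTop d₁), ?_⟩
    rintro _ ⟨d, hd, rfl⟩ _ ⟨d', hd', rfl⟩
    have := dist_triangle_right (d.1 x) (d'.1 x) (d₁.1 x)
    linarith [key d hd, key d' hd']
  choose f hf using fun x => CompleteSpace.complete (hcauchy x)
  have hlim : Tendsto (fun (d : D) x => d.1 x) atTop (𝓝 f) := tendsto_pi_nhds.2 hf
  have hbdd : Bornology.IsBounded (Set.range fun d : D => d.1) := by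
    refine isBounded_iff_forall_norm_le.2 ⟨‖d₀‖ + M, ?_⟩
    rintro _ ⟨d, rfl⟩
    have := hM _ hd₀ _ d.2 (hbot _ d.2)
    calc ‖d.1‖ = ‖d₀ + (d.1 - d₀)‖ := by rw [add_sub_cancel]
      _ ≤ _ := (norm_add_le _ _).trans (by gcongr)
  let T : H →L[ℂ] H := ofTendstoOfBoundedRange f (fun d : D => d.1) hlim hbdd
  have hT : ∀ x, Tendsto (fun d : D => d.1 x) atTop (𝓝 (T x)) := hf
  refine ⟨T, fun d hd => ?_, fun x ε hε => ?_, fun X hX => ?_⟩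
  · refine sub_nonneg.1 (nonneg_of_inner fun x => ?_)
    have h1 : Tendsto (fun d' : D => ⟪d'.1 x - d x, x⟫_ℂ) atTop (𝓝 ⟪T x - d x, x⟫_ℂ) :=
      ((hT x).sub tendsto_const_nhds).inner tendsto_const_nhds
    refine ge_of_tendsto h1 ((eventually_ge_atTop ⟨d, hd⟩).mono fun d' h => ?_)
    exact inner_nonneg (sub_nonneg.2 (show d ≤ d'.1 from h)) x
  · have h1 : Tendsto (fun d : D => (⟪T x - d.1 x, x⟫_ℂ).re) atTop (𝓝 (⟪T x - T x, x⟫_ℂ).re) :=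
      (Complex.continuous_re.tendsto _).comp
        ((tendsto_const_nhds.sub (hT x)).inner tendsto_const_nhds)
    rw [sub_self, inner_zero_left, Complex.zero_re] at h1
    obtain ⟨d, hd⟩ := (h1.eventually_lt_const hε).exists
    exact ⟨d, d.2, hd⟩
  · ext x
    refine tendsto_nhds_unique ((X.continuous.tendsto _).comp (hT x)) ?_
    refine (hT (X x)).congr fun d => ?_
    exact (congrArg (fun S => S x) (hX d d.2)).symm

/-- Vigier's theorem: a bounded directed set of operators has a strong limit. -/
lemma ContinuousLinearMap.exists_strong_sup {D : Set (H →L[ℂ] H)} {t : H →L[ℂ] H}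
    (hne : D.Nonempty) (hdir : DirectedOn (· ≤ ·) D) (ht : ∀ d ∈ D, d ≤ t) :
    ∃ T : H →L[ℂ] H, (∀ d ∈ D, d ≤ T) ∧
      (∀ x, ∀ ε > 0, ∃ d ∈ D, (⟪(T - d) x, x⟫_ℂ).re < ε) ∧
      ∀ X : H →L[ℂ] H, (∀ d ∈ D, X * d = d * X) → X * T = T * X := by
  obtain ⟨d₀, hd₀⟩ := hne
  -- The tail above any fixed `d₀` has a least element and, by directedness, is cofinal in `D`.
  obtain ⟨T, h1, h2, h3⟩ := exists_strong_sup_of_bot (D := {d ∈ D | d₀ ≤ d}) (t := t)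
    ⟨hd₀, le_rfl⟩ (fun d hd => hd.2) (fun a ha b hb => by
      obtain ⟨c, hc, hac, hbc⟩ := hdir a ha.1 b hb.1
      exact ⟨c, ⟨hc, ha.2.trans hac⟩, hac, hbc⟩) (fun d hd => ht d hd.1)
  refine ⟨T, fun d hd => ?_, fun x ε hε => ?_, fun X hX => h3 X fun d hd => hX d hd.1⟩
  · obtain ⟨c, hc, hac, hbc⟩ := hdir d hd d₀ hd₀
    exact hac.trans (h1 c ⟨hc, hbc⟩)
  · obtain ⟨d, hd, h⟩ := h2 x ε hε
    exact ⟨d, hd.1, h⟩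

end Operators

/-! ### Order and suprema inside a von Neumann algebra. -/

namespace VNA

open scoped ComplexOrder
open ContinuousLinearMap

lemma mem_alg_of_commute {A : VNA.{u}} {T : A.space →L[ℂ] A.space}
    (h : ∀ X : A.space →L[ℂ] A.space, (∀ a ∈ A.alg, X * a = a * X) → X * T = T * X) :
    T ∈ A.alg := by
  rw [← SetLike.mem_coe, ← A.alg.centralizer_centralizer]
  exact fun X hX => h X fun a ha => (hX a ha).symm

instance (A : VNA.{u}) : IsClosed (A.alg.toStarSubalgebra : Set (A.space →L[ℂ] A.space)) := by
  rw [VonNeumannAlgebra.coe_toStarSubalgebra, ← A.alg.centralizer_centralizer]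
  exact Set.isClosed_centralizer _

noncomputable instance (A : VNA.{u}) : CStarAlgebra A.Elem :=
  StarSubalgebra.cstarAlgebra A.alg.toStarSubalgebra

/-- The square root of a positive operator commutes with whatever commutes with the operator, so it
stays in the algebra by the double commutant property. -/
lemma isPos_iff {A : VNA.{u}} {a : A.Elem} : IsPos a ↔ 0 ≤ a.1 := by
  constructor
  · rintro ⟨b, rfl⟩
    exact star_mul_self_nonneg b.1
  · intro h
    have hb : CFC.sqrt a.1 ∈ A.alg := by
      refine mem_alg_of_commute fun X hX => ?_
      have hc : Commute a.1 X := (hX a.1 a.2).symm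
      exact (hc.cfcₙ_nnreal NNReal.sqrt).symm
    refine ⟨⟨CFC.sqrt a.1, hb⟩, Subtype.ext ?_⟩
    change a.1 = star (CFC.sqrt a.1) * CFC.sqrt a.1
    rw [(CFC.sqrt_nonneg a.1).isSelfAdjoint.star_eq, CFC.sqrt_mul_sqrt_self a.1 h]

lemma isPos_sub_iff {A : VNA.{u}} {a b : A.Elem} : IsPos (b - a) ↔ a.1 ≤ b.1 :=
  isPos_iff.trans sub_nonneg

lemma isSupSA_unique {A : VNA.{u}} {D : Set A.Elem} {s t : A.Elem} (hs : IsSupSA D s)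
    (ht : IsSupSA D t) : s = t :=
  Subtype.ext (le_antisymm (isPos_sub_iff.1 (hs.2.2 t ht.1 ht.2.1))
    (isPos_sub_iff.1 (ht.2.2 s hs.1 hs.2.1)))

/-- Vigier's strong limit commutes with the commutant, so it lies in the algebra. Approximation of
its quadratic forms makes it the least upper bound. -/
lemma exists_isSupSA {A : VNA.{u}} {D : Set A.Elem} {t : A.Elem} (hne : D.Nonempty)
    (hsa : ∀ d ∈ D, IsSelfAdjoint d) (hdir : DirectedOn (fun a b => IsPos (b - a)) D)
    (ht : ∀ d ∈ D, IsPos (t - d)) :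
    ∃ s, IsSupSA D s ∧ ∀ x, ∀ ε > 0, ∃ d ∈ D, (⟪(s.1 - d.1) x, x⟫_ℂ).re < ε := by
  obtain ⟨T, h1, h2, h3⟩ := exists_strong_sup (D := Subtype.val '' D) (t := t.1) (hne.image _)
    (by
      rintro _ ⟨a, ha, rfl⟩ _ ⟨b, hb, rfl⟩
      obtain ⟨c, hc, hac, hbc⟩ := hdir a ha b hb
      exact ⟨c.1, ⟨c, hc, rfl⟩, isPos_sub_iff.1 hac, isPos_sub_iff.1 hbc⟩)
    (by rintro _ ⟨a, ha, rfl⟩; exact isPos_sub_iff.1 (ht a ha))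
  have hT : T ∈ A.alg := mem_alg_of_commute fun X hX => h3 X (by
    rintro _ ⟨a, ha, rfl⟩; exact hX a.1 a.2)
  have h2' : ∀ x, ∀ ε > 0, ∃ d ∈ D, (⟪(T - d.1) x, x⟫_ℂ).re < ε := by
    intro x ε hε
    obtain ⟨_, ⟨d, hd, rfl⟩, h⟩ := h2 x ε hε
    exact ⟨d, hd, h⟩
  refine ⟨⟨T, hT⟩, ⟨?_, fun d hd => isPos_sub_iff.2 (h1 _ ⟨d, hd, rfl⟩), fun r hr hub => ?_⟩, h2'⟩
  · obtain ⟨d, hd⟩ := hne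
    have e1 : IsSelfAdjoint (T - d.1) := (sub_nonneg.2 (h1 _ ⟨d, hd, rfl⟩)).isSelfAdjoint
    have e2 : IsSelfAdjoint d.1 := congrArg Subtype.val (hsa d hd)
    have := e1.add e2
    rw [sub_add_cancel] at this
    exact Subtype.ext this
  · refine isPos_sub_iff.2 (sub_nonneg.1 (nonneg_of_inner fun x => ?_))
    have hsa' : IsSelfAdjoint (r.1 - T) := by
      obtain ⟨d, hd⟩ := hne
      have e1 : IsSelfAdjoint (T - d.1) := (sub_nonneg.2 (h1 _ ⟨d, hd, rfl⟩)).isSelfAdjoint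
      have e2 : IsSelfAdjoint d.1 := congrArg Subtype.val (hsa d hd)
      have e3 : IsSelfAdjoint r.1 := congrArg Subtype.val hr
      have := e3.sub (e1.add e2)
      rwa [sub_add_cancel] at this
    refine Complex.nonneg_iff.2 ⟨?_, ?_⟩
    · refine le_of_forall_pos_lt_add fun ε hε => ?_
      obtain ⟨d, hd, h⟩ := h2' x ε hε
      have := (Complex.nonneg_iff.1
        (inner_nonneg (sub_nonneg.2 (isPos_sub_iff.1 (hub d hd))) x)).1
      simp only [sub_apply, inner_sub_left, Complex.sub_re] at this h ⊢
      linarith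
    · exact (hsa'.isSymmetric.im_inner_apply_self x).symm

/-- The supremum of a bounded directed set is the supremum of the quadratic forms. -/
lemma IsSupSA.exists_inner_lt {A : VNA.{u}} {D : Set A.Elem} {s : A.Elem} (hne : D.Nonempty)
    (hsa : ∀ d ∈ D, IsSelfAdjoint d) (hdir : DirectedOn (fun a b => IsPos (b - a)) D)
    (hs : IsSupSA D s) (x : A.space) {ε : ℝ} (hε : 0 < ε) :
    ∃ d ∈ D, (⟪(s.1 - d.1) x, x⟫_ℂ).re < ε := by
  obtain ⟨s', hs', h⟩ := exists_isSupSA hne hsa hdir hs.2.1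
  rw [isSupSA_unique hs hs']
  exact h x ε hε

end VNA

/-! ### Approximate units in kernels of characters. -/

section Characters

/-- The kernel of a character, as a closed non-unital `*`-subalgebra. -/
def charKer {A : Type*} [CStarAlgebra A] (φ : A →⋆ₐ[ℂ] ℂ) : NonUnitalStarSubalgebra ℂ A where
  carrier := {a | φ a = 0}
  add_mem' {a b} (ha : φ a = 0) (hb : φ b = 0) := by simp [ha, hb]
  zero_mem' := map_zero φ
  mul_mem' {a b} (ha : φ a = 0) _ := by simp [ha]
  smul_mem' c a (ha : φ a = 0) := by simp [ha]
  star_mem' {a} (ha : φ a = 0) := by simp [map_star, ha]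

instance isClosed_charKer {A : Type*} [CStarAlgebra A] (φ : A →⋆ₐ[ℂ] ℂ) :
    IsClosed (charKer φ : Set A) :=
  isClosed_singleton.preimage (f := φ) (map_continuous φ)

/-- The kernel of a character has an increasing approximate unit. -/
lemma exists_approximateUnit_charKer {A : Type*} [CStarAlgebra A] (φ : A →⋆ₐ[ℂ] ℂ) :
    ∃ D : Set A, D.Nonempty ∧ (∀ d ∈ D, IsPos d ∧ ‖d‖ ≤ 1 ∧ φ d = 0) ∧
      DirectedOn (fun a b => IsPos (b - a)) D ∧
      ∀ a, φ a = 0 → ∀ ε > 0, ∃ d ∈ D, ‖a - a * d‖ < ε := by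
  let _ : PartialOrder (charKer φ) := CStarAlgebra.spectralOrder _
  have : StarOrderedRing (charKer φ) := CStarAlgebra.spectralOrderedRing _
  have hpos : ∀ {x : charKer φ}, 0 ≤ x → IsPos x.1 := by
    intro x hx
    obtain ⟨b, rfl⟩ := CStarAlgebra.nonneg_iff_eq_star_mul_self.1 hx
    exact ⟨b.1, rfl⟩
  refine ⟨Subtype.val '' ({x : charKer φ | 0 ≤ x} ∩ Metric.ball 0 1), ?_, ?_, ?_, ?_⟩
  · exact ⟨0, 0, ⟨le_refl (0 : charKer φ), by simp⟩, rfl⟩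
  · rintro _ ⟨x, ⟨hx, hx1⟩, rfl⟩
    exact ⟨hpos hx, (mem_ball_zero_iff.1 hx1).le, x.2⟩
  · rintro _ ⟨x, hx, rfl⟩ _ ⟨y, hy, rfl⟩
    obtain ⟨z, hz, h1, h2⟩ := CStarAlgebra.directedOn_nonneg_ball x hx y hy
    exact ⟨z.1, ⟨z, hz, rfl⟩, hpos (sub_nonneg.2 h1), hpos (sub_nonneg.2 h2)⟩
  · intro a ha ε hε
    have h := (CStarAlgebra.increasingApproximateUnit (charKer φ)).tendsto_mul_left ⟨a, ha⟩
    obtain ⟨x, hx, hx'⟩ := ((CStarAlgebra.hasBasis_approximateUnit (charKer φ)).tendsto_iff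
      Metric.nhds_basis_ball).1 h ε hε
    -- A basic set of the approximate unit consists of the `y ≥ x` in the closed unit ball, so it
    -- contains `x` itself.
    have := hx' x ⟨le_refl x, mem_closedBall_zero_iff.2 hx.2.le⟩
    rw [Metric.mem_ball, dist_comm, dist_eq_norm] at this
    exact ⟨x.1, ⟨x, ⟨hx.1, mem_ball_zero_iff.2 hx.2⟩, rfl⟩, this⟩

end Characters

section ComplexOrder

open scoped ComplexOrder

lemma Complex.isPos_iff {z : ℂ} : IsPos z ↔ 0 ≤ z := by
  constructor
  · rintro ⟨b, rfl⟩
    exact star_mul_self_nonneg b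
  · intro h
    exact CStarAlgebra.nonneg_iff_eq_star_mul_self.1 h

lemma Complex.isPos_sub_iff {z w : ℂ} : IsPos (w - z) ↔ z ≤ w :=
  Complex.isPos_iff.trans sub_nonneg

end ComplexOrder

/-! ### Normal characters as common eigenvectors. -/

namespace VNA

open scoped ComplexOrder
open ContinuousLinearMap

/-- A normal character is given by a common eigenvector. -/
lemma Nsp.exists_eigenvector {A : VNA.{u}} (φ : A.Nsp) :
    ∃ ξ : A.space, ξ ≠ 0 ∧ ∀ a : A.Elem, a.1 ξ = φ a • ξ := by
  obtain ⟨D, hne, hD, hdir, happ⟩ := exists_approximateUnit_charKer φ.1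
  have hsa : ∀ d ∈ D, IsSelfAdjoint d := fun d hd => by
    obtain ⟨b, rfl⟩ := (hD d hd).1
    exact IsSelfAdjoint.star_mul_self b
  have hle1 : ∀ d ∈ D, IsPos (1 - d) := fun d hd => by
    refine isPos_sub_iff.2 ?_
    exact (CStarAlgebra.norm_le_one_iff_of_nonneg d.1 (isPos_iff.1 (hD d hd).1)).1 (hD d hd).2.1
  obtain ⟨q, hq, -⟩ := exists_isSupSA hne hsa hdir hle1
  -- The only use of normality: `φ` maps `D` to `{0}`, whose supremum is `0`.
  have hφq : φ q = 0 := by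
    have h := φ.2.2 D q hne hsa hdir hq
    obtain ⟨d, hd⟩ := hne
    refine le_antisymm (Complex.isPos_sub_iff.1 (h.2.2 0 (IsSelfAdjoint.zero _) ?_)) ?_
    · rintro _ ⟨e, he, rfl⟩
      rw [show φ.1 e = 0 from (hD e he).2.2, sub_zero]
      exact Complex.isPos_iff.2 le_rfl
    · have := h.2.1 _ ⟨d, hd, rfl⟩
      rw [show φ.1 d = 0 from (hD d hd).2.2] at this
      exact Complex.isPos_sub_iff.1 this
  have hr : IsPos (1 - q) := hq.2.2 1 (IsSelfAdjoint.one _) hle1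
  obtain ⟨c, hc⟩ := hr
  have hkill : ∀ a, φ a = 0 → a * (1 - q) = 0 := by
    intro a ha
    -- With `1 - q = c* c` and `d ≤ q`, `‖c a*‖² = ‖a (1 - q) a*‖ ≤ ‖a (1 - d) a*‖ ≤ ‖a - a d‖ ‖a‖`,
    -- which is arbitrarily small.
    have h0 : c * star a = 0 := by
      refine norm_eq_zero.1 ?_
      by_contra hn
      have hp : 0 < ‖c * star a‖ ^ 2 / (‖a‖ + 1) := by positivity
      obtain ⟨d, hd, hlt⟩ := happ a ha _ hp
      have hle : a.1 * (1 - q.1) * star a.1 ≤ a.1 * (1 - d.1) * star a.1 :=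
        star_right_conjugate_le_conjugate
          (sub_le_sub_left (isPos_sub_iff.1 (hq.2.1 d hd)) 1) a.1
      have hq1 : a.1 * (1 - q.1) * star a.1 = star (c.1 * star a.1) * (c.1 * star a.1) := by
        have := congrArg Subtype.val hc
        change 1 - q.1 = star c.1 * c.1 at this
        rw [this, star_mul, star_star]; simp only [mul_assoc]
      have h1 := CStarAlgebra.norm_le_norm_of_nonneg_of_le
        (by rw [hq1]; exact star_mul_self_nonneg _) hle
      rw [hq1, CStarRing.norm_star_mul_self] at h1
      have h2 : ‖a.1 * (1 - d.1) * star a.1‖ ≤ ‖a - a * d‖ * ‖a‖ := by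
        refine (norm_mul_le _ _).trans_eq ?_
        rw [norm_star, mul_sub, mul_one]; rfl
      have h3 : ‖c * star a‖ ^ 2 ≤ ‖a - a * d‖ * ‖a‖ := by
        rw [sq]; exact h1.trans h2
      rw [lt_div_iff₀ (by positivity)] at hlt
      nlinarith [norm_nonneg (a - a * d)]
    have : a * star c = 0 := by simpa using congrArg star h0
    rw [hc, ← mul_assoc, this, zero_mul]
  have hne0 : (1 - q.1) ≠ 0 := by
    intro h
    have : (1 : A.Elem) - q = 0 := Subtype.ext h
    have h1 : φ.1 (1 - q) = 0 := by rw [this, map_zero]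
    rw [map_sub, map_one, show φ.1 q = 0 from hφq] at h1
    simp at h1
  obtain ⟨x, hx⟩ : ∃ x, (1 - q.1) x ≠ 0 := by
    by_contra! h
    exact hne0 (ContinuousLinearMap.ext h)
  refine ⟨(1 - q.1) x, hx, fun a => ?_⟩
  -- `a - φ(a) 1` lies in the kernel, so it annihilates the range of `1 - q`.
  have h1 := hkill (a - algebraMap ℂ _ (φ a)) (by
    rw [map_sub, AlgHomClass.commutes]; simp)
  have h2 := congrArg (fun S => S.1 x) h1
  change a.1 ((1 - q.1) x) - φ a • ((1 - q.1) x) = 0 at h2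
  exact sub_eq_zero.1 h2

/-- A character given by a common eigenvector is normal. -/
lemma isNormal_of_eigenvector {A : VNA.{u}} (φ : A.Elem →⋆ₐ[ℂ] ℂ) {ξ : A.space} (hξ : ξ ≠ 0)
    (h : ∀ a : A.Elem, a.1 ξ = φ a • ξ) : IsNormal φ := by
  refine ⟨fun a ha => φ.isPos_map ha, fun D s hne hsa hdir hs => ⟨hs.1.map φ, ?_, ?_⟩⟩
  · rintro _ ⟨d, hd, rfl⟩
    rw [← map_sub]
    exact φ.isPos_map (hs.2.1 d hd)
  · intro t ht hub
    have hn : 0 < ‖ξ‖ ^ 2 := by positivity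
    have him : ∀ z : ℂ, IsSelfAdjoint z → z.im = 0 := fun z hz => Complex.conj_eq_iff_im.1 hz
    refine Complex.isPos_iff.2 (Complex.nonneg_iff.2 ⟨?_, ?_⟩)
    · refine le_of_forall_pos_lt_add fun ε hε => ?_
      -- The form of `s - d` at `ξ` is the conjugate of `φ(s) - φ(d)` times `‖ξ‖²`, hence the
      -- scaling of `ε`.
      obtain ⟨d, hd, hlt⟩ := IsSupSA.exists_inner_lt hne hsa hdir hs ξ (mul_pos hε hn)
      have h1 := (Complex.nonneg_iff.1 (Complex.isPos_iff.1 (hub _ ⟨d, hd, rfl⟩))).1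
      have h2 : ⟪(s.1 - d.1) ξ, ξ⟫_ℂ = star (φ s - φ d) * (‖ξ‖ ^ 2 : ℝ) := by
        rw [sub_apply, h, h, ← sub_smul, inner_smul_left, inner_self_eq_norm_sq_to_K]
        push_cast; rfl
      rw [h2, Complex.re_mul_ofReal, Complex.star_def, Complex.conj_re] at hlt
      have h3 := lt_of_mul_lt_mul_right hlt hn.le
      simp only [Complex.sub_re] at h1 h3 ⊢
      linarith
    · exact (him _ (ht.sub (hs.1.map φ))).symm

/-- A common eigenvector gives a normal character. -/
lemma exists_nsp_of_eigenvector {A : VNA.{u}} {ξ : A.space} (hξ : ξ ≠ 0)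
    (h : ∀ a : A.Elem, ∃ z : ℂ, a.1 ξ = z • ξ) : ∃ φ : A.Nsp, ∀ a : A.Elem, a.1 ξ = φ a • ξ := by
  choose f hf using h
  have huniq : ∀ {z w : ℂ}, z • ξ = w • ξ → z = w := fun h => smul_left_injective ℂ hξ h
  let φ : A.Elem →⋆ₐ[ℂ] ℂ :=
    { toFun := f
      map_one' := huniq (by rw [← hf, one_smul]; rfl)
      map_zero' := huniq (by rw [← hf, zero_smul]; rfl)
      map_mul' := fun a b => huniq (by
        rw [← hf, mul_comm, mul_smul, ← hf a, ← map_smul, ← hf b]; rfl)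
      map_add' := fun a b => huniq (by rw [← hf, add_smul, ← hf, ← hf]; rfl)
      commutes' := fun r => huniq (by rw [← hf]; rfl)
      -- Unlike the other laws this needs the inner product: compare eigenvalues in `⟪a* ξ, ξ⟫ = ⟪ξ,
      -- a ξ⟫`.
      map_star' := fun a => by
        have h1 : ⟪(star a).1 ξ, ξ⟫_ℂ = ⟪ξ, a.1 ξ⟫_ℂ := by
          change ⟪(star a.1) ξ, ξ⟫_ℂ = _
          rw [star_eq_adjoint, adjoint_inner_left]
        rw [hf, hf, inner_smul_left, inner_smul_right] at h1
        have h2 := mul_right_cancel₀ (inner_self_ne_zero.2 hξ) h1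
        rw [← h2]; simp }
  exact ⟨⟨φ, isNormal_of_eigenvector φ hξ hf⟩, hf⟩

end VNA

/-! ### Normal characters of tensor products. -/

namespace VNA

open ContinuousLinearMap

/-- The von Neumann algebra generated by `S` commutes with every operator that commutes,
together with its adjoint, with `S`. -/
lemma commute_of_mem_generated {H : Type u} [NormedAddCommGroup H] [InnerProductSpace ℂ H]
    [CompleteSpace H] {S : Set (H →L[ℂ] H)} {X T : H →L[ℂ] H} (h : ∀ s ∈ S, X * s = s * X)
    (h' : ∀ s ∈ S, star X * s = s * star X) (hT : T ∈ generated S) : X * T = T * X := by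
  -- The star-centralizer is the commutant of `{X, X*}`, and a commutant equals its double
  -- commutant.
  let N : VonNeumannAlgebra H :=
    { StarSubalgebra.centralizer ℂ {X} with
      centralizer_centralizer' := Set.centralizer_centralizer_centralizer _ }
  have hN : S ⊆ N := by
    intro s hs
    change s ∈ StarSubalgebra.centralizer ℂ {X}
    rw [StarSubalgebra.mem_centralizer_iff]
    rintro _ rfl
    exact ⟨h s hs, h' s hs⟩
  have : T ∈ StarSubalgebra.centralizer ℂ {X} := hT N hN
  exact ((StarSubalgebra.mem_centralizer_iff ℂ).1 this X rfl).1

variable {A B : VNA.{u}}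

/-- The simple tensors in the Hilbert space tensor product. -/
noncomputable def vec (x : A.space) (y : B.space) : tensorSpace A B :=
  ((x ⊗ₜ[ℂ] y : A.space ⊗[ℂ] B.space) : tensorSpace A B)

lemma tensorOp_vec (a : A.space →L[ℂ] A.space) (b : B.space →L[ℂ] B.space) (x : A.space)
    (y : B.space) : tensorOp a b (vec x y) = vec (a x) (b y) :=
  tensorOp_tmul a b x y

lemma inner_vec (x x' : A.space) (y y' : B.space) :
    ⟪vec x y, vec x' y'⟫_ℂ = ⟪x, x'⟫_ℂ * ⟪y, y'⟫_ℂ := by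
  rw [vec, vec, UniformSpace.Completion.inner_coe, TensorProduct.inner_tmul]

/-- Elementary tensors span a dense subspace. -/
lemma eq_zero_of_inner_vec {v : tensorSpace A B} (h : ∀ x y, ⟪vec x y, v⟫_ℂ = 0) : v = 0 := by
  have key : ∀ w : tensorSpace A B, ⟪w, v⟫_ℂ = 0 := by
    intro w
    induction w using UniformSpace.Completion.induction_on with
    | hp => exact isClosed_eq (by fun_prop) continuous_const
    | ih t =>
      induction t using TensorProduct.induction_on with
      | zero => exact inner_zero_left v
      | tmul x y => exact h x y
      | add s t hs ht => rw [UniformSpace.Completion.coe_add, inner_add_left, hs, ht, add_zero]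
  exact inner_self_eq_zero.1 (key v)

lemma vec_ne_zero {x : A.space} {y : B.space} (hx : x ≠ 0) (hy : y ≠ 0) : vec x y ≠ 0 := by
  intro h
  have := inner_vec x x y y
  rw [h, inner_zero_left] at this
  exact mul_ne_zero (inner_self_ne_zero.2 hx) (inner_self_ne_zero.2 hy) this.symm

/-- The bounded operator `x ↦ x ⊗ y`. -/
noncomputable def vecLeft (y : B.space) : A.space →L[ℂ] tensorSpace A B :=
  UniformSpace.Completion.toComplL ∘L (TensorProduct.mkL ℂ A.space B.space).flip y

/-- The bounded operator `y ↦ x ⊗ y`. -/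
noncomputable def vecRight (x : A.space) : B.space →L[ℂ] tensorSpace A B :=
  UniformSpace.Completion.toComplL ∘L TensorProduct.mkL ℂ A.space B.space x

lemma vecLeft_apply (x : A.space) (y : B.space) : vecLeft y x = vec x y := rfl

lemma vecRight_apply (x : A.space) (y : B.space) : vecRight x y = vec x y := rfl

lemma tensorOp_ext {S T : tensorSpace A B →L[ℂ] tensorSpace A B}
    (h : ∀ x y, S (vec x y) = T (vec x y)) : S = T := by
  rw [← sub_eq_zero, ← star_eq_zero]
  ext v
  refine eq_zero_of_inner_vec fun x y => ?_
  rw [star_eq_adjoint, adjoint_inner_right, sub_apply, h, sub_self, inner_zero_left]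

lemma star_tensorOp (a : A.space →L[ℂ] A.space) (b : B.space →L[ℂ] B.space) :
    star (tensorOp a b) = tensorOp (star a) (star b) := by
  refine tensorOp_ext fun x y => ?_
  rw [← sub_eq_zero]
  refine eq_zero_of_inner_vec fun x' y' => ?_
  rw [inner_sub_right, star_eq_adjoint, adjoint_inner_right, tensorOp_vec, tensorOp_vec, inner_vec,
    inner_vec, star_eq_adjoint, star_eq_adjoint, adjoint_inner_right, adjoint_inner_right, sub_self]

lemma tmul_mul_tmul (a a' : A.Elem) (b b' : B.Elem) :
    tmul a b * tmul a' b' = tmul (a * a') (b * b') :=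
  Subtype.ext (tensorOp_ext fun x y => by
    change tensorOp a.1 b.1 (tensorOp a'.1 b'.1 (vec x y)) =
      tensorOp (a.1 * a'.1) (b.1 * b'.1) (vec x y)
    simp only [tensorOp_vec]; rfl)

/-- An element of the tensor product as an operator on the Hilbert space tensor product. -/
def tensorVal (T : (tensor A B).Elem) : tensorSpace A B →L[ℂ] tensorSpace A B := T.1

lemma tensorVal_tmul (a : A.Elem) (b : B.Elem) : tensorVal (tmul a b) = tensorOp a.1 b.1 := rfl

lemma Nsp.exists_eigenvector_tensor (ω : (tensor A B).Nsp) :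
    ∃ ζ : tensorSpace A B, ζ ≠ 0 ∧ ∀ T, tensorVal T ζ = ω T • ζ :=
  ω.exists_eigenvector

lemma exists_nsp_tensor_of_eigenvector {ζ : tensorSpace A B} (hζ : ζ ≠ 0)
    (h : ∀ T : (tensor A B).Elem, ∃ z : ℂ, tensorVal T ζ = z • ζ) :
    ∃ ω : (tensor A B).Nsp, ∀ T, tensorVal T ζ = ω T • ζ :=
  exists_nsp_of_eigenvector (A := tensor A B) hζ h

/-- Common eigenvectors of the operators `a ⊗ b` with the same eigenvalues are common eigenvectors
of the tensor product, with the same eigenvalues. -/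
lemma inner_smul_eq_of_eigenvectors {ζ ζ' : tensorSpace A B} (f : A.Elem → B.Elem → ℂ)
    (hf : ∀ a b, f (star a) (star b) = star (f a b))
    (h : ∀ a b, tensorVal (tmul a b) ζ = f a b • ζ) (h' : ∀ a b, tensorVal (tmul a b) ζ' = f a b • ζ')
    (T : (tensor A B).Elem) : ⟪ζ, tensorVal T ζ⟫_ℂ • ζ' = ⟪ζ, ζ⟫_ℂ • tensorVal T ζ' := by
  -- The operator `z ↦ ⟪v, z⟫ v'` commutes with `a ⊗ b` because `(a ⊗ b)* v` has the conjugate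
  -- eigenvalue. Keeping `v`, `v'` general also covers its adjoint, where they are swapped.
  have key : ∀ {v v' : tensorSpace A B}, (∀ a b, tensorVal (tmul a b) v = f a b • v) →
      (∀ a b, tensorVal (tmul a b) v' = f a b • v') → ∀ (a : A.Elem) (b : B.Elem),
      InnerProductSpace.rankOne ℂ v' v * tensorOp a.1 b.1 =
        tensorOp a.1 b.1 * InnerProductSpace.rankOne ℂ v' v := by
    intro v v' hv hv' a b
    have h1 : star (tensorOp a.1 b.1) v = star (f a b) • v := by
      rw [star_tensorOp, ← hf]
      exact hv (star a) (star b)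
    have h2 : tensorOp a.1 b.1 v' = f a b • v' := hv' a b
    ext1 z
    rw [mul_apply_eq_comp, mul_apply_eq_comp, InnerProductSpace.rankOne_apply,
      InnerProductSpace.rankOne_apply, ← adjoint_inner_left, ← star_eq_adjoint, h1,
      inner_smul_left, map_smul, h2, smul_smul, mul_comm]
    simp
  have hc := commute_of_mem_generated (X := InnerProductSpace.rankOne ℂ ζ' ζ) (T := tensorVal T)
    (by rintro _ ⟨a, ha, b, hb, rfl⟩; exact key h h' ⟨a, ha⟩ ⟨b, hb⟩)
    (by
      rintro _ ⟨a, ha, b, hb, rfl⟩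
      rw [star_eq_adjoint, InnerProductSpace.adjoint_rankOne]
      exact key h' h ⟨a, ha⟩ ⟨b, hb⟩) T.2
  have := congrArg (fun S => S ζ) hc
  simpa only [mul_apply_eq_comp, InnerProductSpace.rankOne_apply, map_smul] using this

lemma Nsp.ext {A : VNA.{u}} {φ ψ : A.Nsp} (h : ∀ a, φ a = ψ a) : φ = ψ :=
  Subtype.ext (StarAlgHom.ext h)

/-- A normal character on the tensor product is determined by its values on simple tensors. -/
lemma Nsp.tensor_ext {ω ω' : (tensor A B).Nsp} (h : ∀ a b, ω (tmul a b) = ω' (tmul a b)) :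
    ω = ω' := by
  obtain ⟨ζ, hζ, e⟩ := ω.exists_eigenvector_tensor
  obtain ⟨ζ', hζ', e'⟩ := ω'.exists_eigenvector_tensor
  refine Nsp.ext fun T => ?_
  have := inner_smul_eq_of_eigenvectors (ζ := ζ) (ζ' := ζ') (fun a b => ω (tmul a b))
    (fun a b => by
      have : tmul (star a) (star b) = star (tmul a b) := Subtype.ext (star_tensorOp a.1 b.1).symm
      rw [this]
      exact map_star ω.1 _)
    (fun a b => e _) (fun a b => by rw [h]; exact e' _) T
  rw [e T, e' T, inner_smul_right, mul_comm, mul_smul] at this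
  exact smul_left_injective ℂ hζ' (smul_right_injective _ (inner_self_ne_zero.2 hζ) this)

/-- The product of two normal characters. -/
lemma Nsp.exists_tensor (φ : A.Nsp) (ψ : B.Nsp) :
    ∃ ω : (tensor A B).Nsp, ∀ a b, ω (tmul a b) = φ a * ψ b := by
  obtain ⟨ξ, hξ, e⟩ := φ.exists_eigenvector
  obtain ⟨η, hη, e'⟩ := ψ.exists_eigenvector
  have hne : vec ξ η ≠ 0 := vec_ne_zero hξ hη
  have h : ∀ (a : A.Elem) (b : B.Elem), tensorVal (tmul a b) (vec ξ η) = (φ a * ψ b) • vec ξ η := by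
    intro a b
    rw [tensorVal_tmul, tensorOp_vec, e, e', ← vecLeft_apply, map_smul, vecLeft_apply, ← vecRight_apply, map_smul,
      vecRight_apply, smul_smul]
  -- Taking both eigenvectors equal to `ξ ⊗ η` makes it an eigenvector of every `T`, with eigenvalue
  -- its Rayleigh quotient.
  obtain ⟨ω, hω⟩ := exists_nsp_tensor_of_eigenvector hne fun T => by
    have := inner_smul_eq_of_eigenvectors (fun a b => φ a * ψ b) (fun a b => by
      rw [show φ (star a) = star (φ a) from map_star φ.1 a,
        show ψ (star b) = star (ψ b) from map_star ψ.1 b, star_mul']) h h T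
    refine ⟨(⟪vec ξ η, vec ξ η⟫_ℂ)⁻¹ * ⟪vec ξ η, tensorVal T (vec ξ η)⟫_ℂ, ?_⟩
    rw [mul_smul]
    exact (inv_smul_eq_iff₀ (inner_self_ne_zero.2 hne)).2 this |>.symm
  exact ⟨ω, fun a b => smul_left_injective ℂ hne ((hω (tmul a b)).symm.trans (h a b))⟩

/-- Every normal character on the tensor product is a product of normal characters. -/
lemma Nsp.exists_eq_mul (ω : (tensor A B).Nsp) :
    ∃ (φ : A.Nsp) (ψ : B.Nsp), ∀ a b, ω (tmul a b) = φ a * ψ b := by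
  obtain ⟨ζ, hζ, e⟩ := ω.exists_eigenvector_tensor
  obtain ⟨x, y, hxy⟩ : ∃ x y, ⟪vec x y, ζ⟫_ℂ ≠ 0 := by
    by_contra! h
    exact hζ (eq_zero_of_inner_vec h)
  have star_vec : ∀ (a : A.Elem) (b : B.Elem) x y,
      ⟪vec ((star a.1) x) ((star b.1) y), ζ⟫_ℂ = ω (tmul a b) * ⟪vec x y, ζ⟫_ℂ := by
    intro a b x y
    rw [← tensorOp_vec, ← star_tensorOp, star_eq_adjoint, adjoint_inner_left, ← tensorVal_tmul, e,
      inner_smul_right]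
  -- The contraction of `ζ` with `y` is an eigenvector: pairing with `v` gives `⟪a* v ⊗ y, ζ⟫ = ω(a
  -- ⊗ 1) ⟪v ⊗ y, ζ⟫`. It is nonzero since its pairing with `x` is.
  have hA : ∀ a : A.Elem,
      a.1 (adjoint (vecLeft y) ζ) = ω (tmul a 1) • adjoint (vecLeft y) ζ := by
    intro a
    refine ext_inner_left ℂ fun v => ?_
    rw [← adjoint_inner_left, adjoint_inner_right, inner_smul_right, adjoint_inner_right,
      vecLeft_apply, vecLeft_apply, ← star_vec, star_eq_adjoint]
    simp
  have hB : ∀ b : B.Elem,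
      b.1 (adjoint (vecRight x) ζ) = ω (tmul 1 b) • adjoint (vecRight x) ζ := by
    intro b
    have h1 : star (1 : A.Elem).1 x = x := by
      rw [show (1 : A.Elem).1 = 1 from rfl, star_one]; rfl
    refine ext_inner_left ℂ fun v => ?_
    rw [← adjoint_inner_left, adjoint_inner_right, inner_smul_right, adjoint_inner_right,
      vecRight_apply, vecRight_apply, ← star_eq_adjoint]
    simpa [h1] using star_vec 1 b x v
  have hneA : adjoint (vecLeft y) ζ ≠ 0 := fun h => hxy (by
    rw [← vecLeft_apply, ← adjoint_inner_right, h, inner_zero_right])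
  have hneB : adjoint (vecRight x) ζ ≠ 0 := fun h => hxy (by
    rw [← vecRight_apply, ← adjoint_inner_right, h, inner_zero_right])
  obtain ⟨φ, hφ⟩ := exists_nsp_of_eigenvector hneA fun a => ⟨_, hA a⟩
  obtain ⟨ψ, hψ⟩ := exists_nsp_of_eigenvector hneB fun b => ⟨_, hB b⟩
  refine ⟨φ, ψ, fun a b => ?_⟩
  have h1 : φ a = ω (tmul a 1) := smul_left_injective ℂ hneA ((hφ a).symm.trans (hA a))
  have h2 : ψ b = ω (tmul 1 b) := smul_left_injective ℂ hneB ((hψ b).symm.trans (hB b))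
  rw [h1, h2]
  refine Eq.trans ?_ (map_mul ω.1 _ _)
  rw [tmul_mul_tmul, mul_one, one_mul]

lemma Nsp.existsUnique_eq_mul (ω : (tensor A B).Nsp) :
    ∃! p : A.Nsp × B.Nsp, ∀ a b, ω (tmul a b) = p.1 a * p.2 b := by
  obtain ⟨φ, ψ, h⟩ := ω.exists_eq_mul
  refine ⟨(φ, ψ), h, fun p hp => Prod.ext (Nsp.ext fun a => ?_) (Nsp.ext fun b => ?_)⟩
  · have := (hp a 1).symm.trans (h a 1)
    rwa [show p.2 1 = 1 from map_one p.2.1, show ψ 1 = 1 from map_one ψ.1, mul_one, mul_one] at this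
  · have := (hp 1 b).symm.trans (h 1 b)
    rwa [show p.1 1 = 1 from map_one p.1.1, show φ 1 = 1 from map_one φ.1, one_mul, one_mul] at this

lemma Nsp.existsUnique_tensor (φ : A.Nsp) (ψ : B.Nsp) :
    ∃! ω : (tensor A B).Nsp, ∀ a b, ω (tmul a b) = φ a * ψ b := by
  obtain ⟨ω, h⟩ := Nsp.exists_tensor φ ψ
  exact ⟨ω, h, fun ω' h' => Nsp.tensor_ext fun a b => (h' a b).trans (h a b).symm⟩

variable (A B) in
/-- Normal characters on a tensor product are pairs of normal characters. -/
noncomputable def nspTensorEquiv : (tensor A B).Nsp ≃ A.Nsp × B.Nsp where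
  toFun ω := ω.existsUnique_eq_mul.choose
  invFun p := (Nsp.existsUnique_tensor p.1 p.2).choose
  left_inv ω := Nsp.tensor_ext fun a b =>
    ((Nsp.existsUnique_tensor _ _).choose_spec.1 a b).trans
      (ω.existsUnique_eq_mul.choose_spec.1 a b).symm
  right_inv p := ((Nsp.existsUnique_tensor p.1 p.2).choose.existsUnique_eq_mul.choose_spec.2 p
    (Nsp.existsUnique_tensor p.1 p.2).choose_spec.1).symm

lemma nspTensorEquiv_spec (ω : (tensor A B).Nsp) (a : A.Elem) (b : B.Elem) :
    ω (tmul a b) = (nspTensorEquiv A B ω).1 a * (nspTensorEquiv A B ω).2 b :=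
  ω.existsUnique_eq_mul.choose_spec.1 a b

/-- The composed pair factors `ω ∘ F` on elementary tensors, so uniqueness of the factors applies.
-/
lemma nspTensorEquiv_comp {A' B' : VNA.{u}} (f : A ⟶ A') (g : B ⟶ B')
    (F : tensor A B ⟶ tensor A' B')
    (hF : ∀ a b, hom F (tmul a b) = tmul (hom f a) (hom g b)) (ω : (tensor A' B').Nsp) :
    nspTensorEquiv A B (ω.comp F) =
      ((nspTensorEquiv A' B' ω).1.comp f, (nspTensorEquiv A' B' ω).2.comp g) := by
  refine ((ω.comp F).existsUnique_eq_mul.choose_spec.2 _ fun a b => ?_).symm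
  change ω (hom F (tmul a b)) = _
  rw [hF]
  exact nspTensorEquiv_spec ω _ _

/-- The tensor unit has exactly one normal character. -/
lemma nonempty_unique_nsp_unit : Nonempty (Unique unit.{u}.Nsp) := by
  let ξ : unit.{u}.space := EuclideanSpace.single PUnit.unit (1 : ℂ)
  have hspan : ∀ v : unit.{u}.space,
      v = (show EuclideanSpace ℂ PUnit.{u + 1} from v) PUnit.unit • ξ := by
    intro v
    refine PiLp.ext (p := 2) (α := fun _ : PUnit.{u + 1} => ℂ) fun i => ?_
    change _ = _ * (EuclideanSpace.single PUnit.unit (1 : ℂ)) i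
    simp
  have hξ : ξ ≠ 0 := by
    change EuclideanSpace.single PUnit.unit (1 : ℂ) ≠ 0
    simp
  obtain ⟨φ, hφ⟩ := exists_nsp_of_eigenvector hξ fun a => ⟨_, hspan (a.1 ξ)⟩
  refine ⟨⟨⟨φ⟩, fun ψ => Nsp.ext fun a => ?_⟩⟩
  obtain ⟨η, hη, h⟩ := ψ.exists_eigenvector
  have h1 := h a
  -- `η` is a multiple of `ξ`, so its eigenvalues are those of `φ`.
  rw [hspan η, map_smul, hφ, smul_comm, ← hspan η] at h1
  exact (smul_left_injective ℂ hη h1).symm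

end VNA

/-! ### Direct sums as products, and their normal characters. -/

namespace VNA

open ContinuousLinearMap
open scoped ComplexOrder

variable {ι : Type u} (A : ι → VNA.{u})

/-- An element of the direct sum as an operator on the Hilbert space direct sum. -/
def sumVal (T : (directSum A).Elem) : sumSpace A →L[ℂ] sumSpace A := T.1

lemma sumVal_apply (T : (directSum A).Elem) (x : sumSpace A) (i : ι) :
    sumVal A T x i = (sumProjHom A i T).1 (x i) :=
  IsDiag.apply (A := A) T.2 i x

variable {A} in
-- The quadratic form of `T` is the sum of those of its entries, so no roots of the entries need be
-- assembled.
lemma isPos_directSum_iff {T : (directSum A).Elem} :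
    IsPos T ↔ ∀ i, IsPos (sumProjHom A i T) := by
  refine ⟨fun h i => (sumProjHom A i).isPos_map h, fun h => isPos_iff.2 ?_⟩
  change 0 ≤ sumVal A T
  refine nonneg_of_inner fun x => ?_
  rw [lp.inner_eq_tsum]
  refine tsum_nonneg fun i => ?_
  rw [sumVal_apply]
  exact inner_nonneg (isPos_iff.1 (h i)) _

/-- The diagonal operator with a given bounded family of entries. -/
noncomputable def diagOp (a : ∀ i, (A i).space →L[ℂ] (A i).space) (C : ℝ) (h : ∀ i, ‖a i‖ ≤ C) :
    sumSpace A →L[ℂ] sumSpace A :=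
  -- Coordinatewise domination by `C • x` yields both square-summability and the norm bound. The
  -- bound is `|C|` since `C` may be negative when `ι` is empty.
  have hle : ∀ (x : sumSpace A) i, ‖a i (x i)‖ ≤ ‖((C : ℂ) • x : sumSpace A) i‖ := fun x i => by
    refine ((a i).le_of_opNorm_le (h i) _).trans ?_
    rw [lp.coeFn_smul, Pi.smul_apply, norm_smul, Complex.norm_real]
    gcongr
    exact le_abs_self C
  LinearMap.mkContinuous
    { toFun := fun x => ⟨fun i => a i (x i), (lp.memℓp ((C : ℂ) • x)).mono' (hle x)⟩
      map_add' := fun x y => by ext i; exact map_add (a i) _ _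
      map_smul' := fun c x => by ext i; exact map_smul (a i) _ _ } |C| fun x => by
    refine (lp.norm_mono two_ne_zero (y := (C : ℂ) • x) (hle x)).trans ?_
    rw [norm_smul, Complex.norm_real, Real.norm_eq_abs]

variable {A} in
/-- A family of `*`-homomorphisms into the summands, as a function into the direct sum. -/
noncomputable def sumLiftFun {B : VNA.{u}} (f : ∀ i, B.Elem →⋆ₐ[ℂ] (A i).Elem) (b : B.Elem) :
    (directSum A).Elem :=
  -- The entries are uniformly bounded because `*`-homomorphisms are contractive.
  ⟨diagOp A (fun i => (f i b).1) ‖b‖ fun i => NonUnitalStarAlgHom.norm_apply_le (f i) b,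
    fun i => ⟨(f i b).1, (f i b).2, fun _ => rfl⟩⟩

variable {A} in
lemma sumProjHom_sumLiftFun {B : VNA.{u}} (f : ∀ i, B.Elem →⋆ₐ[ℂ] (A i).Elem) (b : B.Elem)
    (i : ι) : sumProjHom A i (sumLiftFun f b) = f i b :=
  Subtype.ext (IsDiag.entry_eq (A := A) fun _ => rfl)

variable {A} in
/-- The `*`-homomorphism into the direct sum induced by a family of `*`-homomorphisms. -/
noncomputable def sumLiftHom {B : VNA.{u}} (f : ∀ i, B.Elem →⋆ₐ[ℂ] (A i).Elem) :
    B.Elem →⋆ₐ[ℂ] (directSum A).Elem where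
  toFun := sumLiftFun f
  map_one' := elem_ext A fun i => by rw [sumProjHom_sumLiftFun, map_one, map_one]
  map_zero' := elem_ext A fun i => by rw [sumProjHom_sumLiftFun, map_zero, map_zero]
  map_mul' a b := elem_ext A fun i => by simp only [sumProjHom_sumLiftFun, map_mul]
  map_add' a b := elem_ext A fun i => by simp only [sumProjHom_sumLiftFun, map_add]
  commutes' r := elem_ext A fun i => by
    rw [sumProjHom_sumLiftFun, AlgHomClass.commutes, AlgHomClass.commutes]
  map_star' a := elem_ext A fun i => by simp only [sumProjHom_sumLiftFun, map_star]

variable {A} in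
-- Positivity in the direct sum is entrywise, so least upper bounds can be checked entry by entry.
lemma isNormal_sumLiftHom {B : VNA.{u}} {f : ∀ i, B.Elem →⋆ₐ[ℂ] (A i).Elem}
    (hf : ∀ i, IsNormal (f i)) : IsNormal (sumLiftHom f) := by
  refine ⟨fun a ha => (sumLiftHom f).isPos_map ha, fun D s hne hsa hdir hs =>
    ⟨hs.1.map _, ?_, fun t ht hub => isPos_directSum_iff.2 fun i => ?_⟩⟩
  · rintro _ ⟨d, hd, rfl⟩
    rw [← map_sub]
    exact (sumLiftHom f).isPos_map (hs.2.1 d hd)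
  · rw [map_sub, show sumProjHom A i (sumLiftHom f s) = f i s from sumProjHom_sumLiftFun f s i]
    refine ((hf i).2 D s hne hsa hdir hs).2.2 _ (ht.map _) ?_
    rintro _ ⟨d, hd, rfl⟩
    have := (sumProjHom A i).isPos_map (hub _ ⟨d, hd, rfl⟩)
    rwa [map_sub, show sumProjHom A i (sumLiftHom f d) = f i d from
      sumProjHom_sumLiftFun f d i] at this

/-- The direct sum is the product. -/
noncomputable def isLimitDirectSumFan : IsLimit (directSumFan A) :=
  Fan.IsLimit.mk _
    (fun s => (⟨sumLiftHom fun i => hom (s.proj i), isNormal_sumLiftHom fun i =>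
      isNormal_hom (s.proj i)⟩ : NormalMIU s.pt (directSum A)))
    (fun _ i => Subtype.ext (StarAlgHom.ext fun b => sumProjHom_sumLiftFun _ b i))
    (fun s _ hm => Subtype.ext (StarAlgHom.ext fun b => elem_ext A fun i =>
      (DFunLike.congr_fun (congrArg hom (hm i)) b).trans
        (sumProjHom_sumLiftFun (fun i => hom (s.proj i)) b i).symm))

/-- Normal characters on a direct sum factor uniquely through a unique summand. -/
lemma bijective_nsp_directSum : Function.Bijective
    (fun p : (Σ i, (A i).Nsp) => (p.2.comp (sumProj A p.1) : (directSum A).Nsp)) := by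
  have happ : ∀ (p : Σ i, (A i).Nsp) T,
      (p.2.comp (sumProj A p.1) : (directSum A).Nsp) T = p.2 (sumProjHom A p.1 T) :=
    fun _ _ => rfl
  constructor
  · rintro ⟨i, φ⟩ ⟨j, ψ⟩ h
    have h1 : ∀ T, φ (sumProjHom A i T) = ψ (sumProjHom A j T) := fun T => by
      rw [← happ ⟨i, φ⟩, ← happ ⟨j, ψ⟩]
      exact congrArg (fun ω : (directSum A).Nsp => ω T) h
    obtain rfl : j = i := by
      by_contra hne
      -- The unit of summand `i` separates the two: it is sent to `1` through `i` and to `0` through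
      -- `j`.
      have := h1 (blockElem A i 1)
      rw [sumProjHom_blockElem, sumProjHom_blockElem_ne A hne,
        show φ 1 = 1 from map_one φ.1, show ψ 0 = 0 from map_zero ψ.1] at this
      exact one_ne_zero this
    obtain rfl : φ = ψ := Nsp.ext fun a => by
      have := h1 (blockElem A j a)
      rwa [sumProjHom_blockElem] at this
    rfl
  · intro ω
    obtain ⟨ζ, hζ, e⟩ : ∃ ζ : sumSpace A, ζ ≠ 0 ∧ ∀ T, sumVal A T ζ = ω T • ζ :=
      ω.exists_eigenvector
    obtain ⟨i, hi⟩ : ∃ i, ζ i ≠ 0 := by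
      by_contra! h
      exact hζ (lp.ext (funext h))
    have e' : ∀ T, (sumProjHom A i T).1 (ζ i) = ω T • ζ i := fun T => by
      rw [← sumVal_apply, e]; rfl
    -- On the coordinate `ζ i`, an element `a` of the summand acts as its block does, so its
    -- eigenvalue is the value of `ω` on the block.
    obtain ⟨φ, hφ⟩ := exists_nsp_of_eigenvector hi fun a => ⟨ω (blockElem A i a), by
      rw [← e', sumProjHom_blockElem]⟩
    exact ⟨⟨i, φ⟩, Nsp.ext fun T => smul_left_injective ℂ hi ((hφ _).symm.trans (e' T))⟩

/-- The normal spectrum functor sends the direct sum to a product. -/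
noncomputable def isLimitMapConeDirectSumFan : IsLimit (nsp.mapCone (directSumFan A)) :=
  (isLimitMapConeFanMkEquiv nsp A (sumProj A)).symm <|
    let e := Equiv.ofBijective _ (bijective_nsp_directSum A)
    have he : ∀ i (φ : (A i).Nsp), e.symm (φ.comp (sumProj A i)) = ⟨i, φ⟩ := fun i φ =>
      e.symm_apply_apply ⟨i, φ⟩
    -- A product in the opposite category is a disjoint union of sets: a map out of it is defined by
    -- locating the summand of `ω` through `e`.
    Fan.IsLimit.mk _
      (fun s => Quiver.Hom.op (X := (directSum A).Nsp) (Y := s.pt.unop)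
        (TypeCat.ofHom fun ω => (s.proj (e.symm ω).1).unop (e.symm ω).2))
      (fun s i => Quiver.Hom.unop_inj (by
        ext φ
        exact congrArg (fun p : Σ i, (A i).Nsp => (s.proj p.1).unop p.2) (he i φ)))
      (fun s _ hm => Quiver.Hom.unop_inj (by
        ext ω
        obtain ⟨⟨i, φ⟩, rfl⟩ := e.surjective ω
        exact (ConcreteCategory.congr_hom (congrArg Quiver.Hom.unop (hm i)) φ).trans
          (congrArg (fun p : Σ i, (A i).Nsp => (s.proj p.1).unop p.2) (he i φ)).symm))

/-- A discrete diagram is isomorphic to a family of objects, and preserving one limit cone of it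
suffices. -/
lemma preservesLimitsOfShape_nsp (ι : Type u) :
    PreservesLimitsOfShape (Discrete ι) nsp.{u} where
  preservesLimit {K} :=
    have : PreservesLimit (Discrete.functor (K.obj ∘ Discrete.mk)) nsp.{u} :=
      preservesLimit_of_preserves_limit_cone (isLimitDirectSumFan _) (isLimitMapConeDirectSumFan _)
    preservesLimit_of_iso_diagram nsp Discrete.natIsoFunctor.symm

end VNA

theorem mainTheorem8 :
    -- the direct sum is the product, and every normal character on it is, for a unique summand and
    -- a unique normal character on that summand, the projection followed by that character
    (∀ (ι : Type u) (A : ι → VNA.{u}),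
      Nonempty (IsLimit (VNA.directSumFan A)) ∧
      Function.Bijective
        (fun p : (Σ i, (A i).Nsp) => (p.2.comp (VNA.sumProj A p.1) : (VNA.directSum A).Nsp))) ∧
    -- preservation of products
    (∀ ι : Type u, PreservesLimitsOfShape (Discrete ι) VNA.nsp.{u}) ∧
    -- normal characters on a tensor product are unique products of normal characters
    (∀ (A B : VNA.{u}) (ω : (VNA.tensor A B).Nsp), ∃! p : A.Nsp × B.Nsp,
      ∀ (a : A.Elem) (b : B.Elem), ω (VNA.tmul a b) = p.1 a * p.2 b) ∧
    (∀ (A B : VNA.{u}) (φ : A.Nsp) (ψ : B.Nsp), ∃! ω : (VNA.tensor A B).Nsp,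
      ∀ (a : A.Elem) (b : B.Elem), ω (VNA.tmul a b) = φ a * ψ b) ∧
    -- preservation of tensors
    (∃ e : ∀ A B : VNA.{u}, (VNA.tensor A B).Nsp ≃ A.Nsp × B.Nsp,
      (∀ (A B : VNA.{u}) (ω : (VNA.tensor A B).Nsp) (a : A.Elem) (b : B.Elem),
        ω (VNA.tmul a b) = (e A B ω).1 a * (e A B ω).2 b) ∧
      (∀ (A A' B B' : VNA.{u}) (f : A ⟶ A') (g : B ⟶ B') (F : VNA.tensor A B ⟶ VNA.tensor A' B'),
        (∀ (a : A.Elem) (b : B.Elem),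
          VNA.hom F (VNA.tmul a b) = VNA.tmul (VNA.hom f a) (VNA.hom g b)) →
        ∀ ω : (VNA.tensor A' B').Nsp,
          e A B (ω.comp F) = ((e A' B' ω).1.comp f, (e A' B' ω).2.comp g))) ∧
    Nonempty (Unique VNA.unit.{u}.Nsp) :=
  ⟨fun _ A => ⟨⟨VNA.isLimitDirectSumFan A⟩, VNA.bijective_nsp_directSum A⟩,
    VNA.preservesLimitsOfShape_nsp, fun _ _ ω => ω.existsUnique_eq_mul,
    fun _ _ φ ψ => VNA.Nsp.existsUnique_tensor φ ψ,
    ⟨VNA.nspTensorEquiv, fun _ _ => VNA.nspTensorEquiv_spec,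
      fun _ _ _ _ => VNA.nspTensorEquiv_comp⟩,
    VNA.nonempty_unique_nsp_unit⟩
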